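/- Let $f,g:\mathbb{R}^n\to\mathbb{R}\cup\{\infty\}$ be closed, proper and convex. Consider the primal problem (P) of minimizing $f(x)+g(x)$ over $x\in\mathbb{R}^n$ and the dual problem of maximizing $-f^*(\nu)-g^*(-\nu)$ over $\nu\in\mathbb{R}^n$, where $f^*(y)=\sup_x\{y^Tx-f(x)\}$ is the conjugate, with optimal values $$p^\star=\inf_{x}\{f(x)+g(x)\},\qquad d^\star=\sup_{\nu}\{-f^*(\nu)-g^*(-\nu)\}.$$ Assume that $d^\star=p^\star$ is finite and that (P) is feasible (that is, $f(x)+g(x)<\infty$ for some $x$) but has no solution (that is, no $x$ satisfies $f(x)+g(x)=p^\star$). Let $\gamma>0$ and $z^0\in\mathbb{R}^n$ be arbitrary, and let the iterates of Douglas–Rachford splitting be given for $k=0,1,2,\dots$ by $$x^{k+1/2}=\mathrm{Prox}_{\gamma f}(z^k),\qquad x^{k+1}=\mathrm{Prox}_{\gamma g}(2x^{k+1/2}-z^k),\qquad z^{k+1}=z^k+x^{k+1}-x^{k+1/2},$$ where $\mathrm{Prox}_h(z)=\operatorname{argmin}_{x\in\mathbb{R}^n}\{h(x)+\tfrac12\|x-z\|^2\}$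 with the Euclidean norm. Then $x^{k+1}-x^{k+1/2}\to 0$, $$\lim_{k\to\infty}\frac1{k+1}\sum_{i=0}^k\left(f(x^{i+1/2})+g(x^{i+1})\right)=p^\star,\qquad \liminf_{k\to\infty}\left(f(x^{k+1/2})+g(x^{k+1})\right)=p^\star,$$ and neither of the sequences $(x^{k+1/2})_k$ and $(x^{k+1})_k$ converges. -/

import Mathlib

open scoped Pointwise Topology

noncomputable section

namespace DRS

/-- The space `ℝⁿ` with its Euclidean norm and inner product. -/
abbrev Vec (n : ℕ) : Type := EuclideanSpace ℝ (Fin n)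

/-- The effective domain of an extended-real-valued function. -/
def dom {n : ℕ} (f : Vec n → EReal) : Set (Vec n) := {x | f x < ⊤}

/-- Closed, proper and convex (CPC) functions `ℝⁿ → ℝ ∪ {∞}`: the value `-∞` is excluded,
the function is finite somewhere, its epigraph is closed, and the convexity inequality holds
(with the convention `0 · ∞ = 0` of `EReal`). -/
structure IsCPC {n : ℕ} (f : Vec n → EReal) : Prop where
  ne_bot : ∀ x, f x ≠ ⊥
  proper : ∃ x, f x < ⊤
  closed : IsClosed {q : Vec n × ℝ | f q.1 ≤ (q.2 : EReal)}
  convex : ∀ x y : Vec n, ∀ θ : ℝ, 0 ≤ θ → θ ≤ 1 →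
    f (θ • x + (1 - θ) • y) ≤ (θ : EReal) * f x + ((1 - θ : ℝ) : EReal) * f y

/-- The conjugate `f*(y) = sup_x {yᵀx - f(x)}`. -/
def conj {n : ℕ} (f : Vec n → EReal) (y : Vec n) : EReal :=
  ⨆ x : Vec n, ((inner ℝ y x : ℝ) : EReal) - f x

/-- The primal optimal value `p⋆ = inf_x {f(x) + g(x)}`. -/
def primalValue {n : ℕ} (f g : Vec n → EReal) : EReal :=
  ⨅ x : Vec n, f x + g x

/-- The dual optimal value `d⋆ = sup_ν {-f*(ν) - g*(-ν)}`. -/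
def dualValue {n : ℕ} (f g : Vec n → EReal) : EReal :=
  ⨆ ν : Vec n, -conj f ν - conj g (-ν)

/-- The primal problem is feasible: `0 ∈ dom f - dom g`. -/
def PrimalFeasible {n : ℕ} (f g : Vec n → EReal) : Prop :=
  (0 : Vec n) ∈ dom f - dom g

/-- `x` is a solution of the primal problem: a feasible point attaining the optimal value. -/
def IsPrimalSolution {n : ℕ} (f g : Vec n → EReal) (x : Vec n) : Prop :=
  x ∈ dom f ∧ x ∈ dom g ∧ f x + g x = primalValue f g

/-- The scaled function `γ f`. -/
def scale {n : ℕ} (γ : ℝ) (f : Vec n → EReal) (x : Vec n) : EReal := (γ : EReal) * f x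

/-- The objective `f(x) + (1/2)‖x - z‖²` that defines the proximal operator at `z`. -/
def proxObjective {n : ℕ} (f : Vec n → EReal) (z x : Vec n) : EReal :=
  f x + (((1 / 2) * ‖x - z‖ ^ 2 : ℝ) : EReal)

/-- The proximal operator `Prox_f(z) = argmin_x {f(x) + (1/2)‖x - z‖²}`. For a CPC function the
minimizer exists and is unique, so the choice made here is no choice. -/
def prox {n : ℕ} (f : Vec n → EReal) (z : Vec n) : Vec n :=
  Classical.epsilon fun x => ∀ y, proxObjective f z x ≤ proxObjective f z y

/-- Douglas-Rachford splitting with parameter `γ`, started at the arbitrary point `z 0`.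
Here `z k`, `xh k` and `x (k + 1)` are the iterates usually written `z^k`, `x^{k+1/2}` and
`x^{k+1}`; the entry `x 0` plays no role. -/
structure IsDRS {n : ℕ} (γ : ℝ) (f g : Vec n → EReal) (z xh x : ℕ → Vec n) : Prop where
  half : ∀ k, xh k = prox (scale γ f) (z k)
  full : ∀ k, x (k + 1) = prox (scale γ g) ((2 : ℝ) • xh k - z k)
  next : ∀ k, z (k + 1) = z k + x (k + 1) - xh k

end DRS

end

/-! The proof combines two estimates for the step `Δₖ = zᵏ⁺¹ - zᵏ = xᵏ⁺¹ - xᵏ⁺¹ᐟ²` and the value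
`φₖ = f(xᵏ⁺¹ᐟ²) + g(xᵏ⁺¹)`. The optimality conditions of the two proximal steps give, for every
primal feasible `x` with value `s`,
`2γ(φₖ - s) ≤ ‖zᵏ - x‖² - ‖zᵏ⁺¹ - x‖² - ‖Δₖ‖²` (`two_mul_gap_le`),
and the Fenchel inequality gives, for every dual feasible `ν` with value `d`,
`d - ⟪ν, Δₖ⟫ ≤ φₖ`.

Summing both over `k < N`, the linear term `2γ⟪ν, zᴺ - x⟫` is absorbed by `‖zᴺ - x‖²`, which leaves
`∑ ‖Δₖ‖² ≤ C + 2γN(s - d)` with `C` independent of `N`. As `‖Δₖ‖` is nonincreasing (the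
Douglas-Rachford operator is nonexpansive) and `s - d` is arbitrarily small by strong duality,
`Δₖ → 0` (`tendsto_step_zero`). Then the first estimate bounds the averages of `φₖ` from above by
`s + O(1/N)`, and the second bounds `φₖ` from below by `d - o(1)`, so that the averages and the
lower limit equal `p⋆`. If one of the two sequences converged, both would have the same limit, which
would be a primal solution by lower semicontinuity.

A dual feasible `ν` also supplies the affine minorants of `f` and `g` from which the existence of
proximal points follows (`exists_proxObjective_min`).
-/

open Filter

namespace DRS

variable {n : ℕ}

/-! ### Extended-real-valued convex functions -/

theorem IsCPC.exists_coe {f : Vec n → EReal} (hf : IsCPC f) {x : Vec n} (hx : f x < ⊤) :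
    ∃ r : ℝ, f x = r :=
  ⟨(f x).toReal, (EReal.coe_toReal hx.ne (hf.ne_bot x)).symm⟩

theorem IsCPC.lowerSemicontinuous {f : Vec n → EReal} (hf : IsCPC f) :
    LowerSemicontinuous f := by
  rw [lowerSemicontinuous_iff_isClosed_preimage]
  intro c
  induction c with
  | bot =>
    convert isClosed_empty
    ext x
    simpa using hf.ne_bot x
  | top => simp
  | coe r =>
    exact hf.closed.preimage (Continuous.prodMk_left r)

/-- A real value of the conjugate is the constant of an affine minorant (Fenchel's inequality). -/
theorem IsCPC.exists_conj_eq {f : Vec n → EReal} (hf : IsCPC f) {ν : Vec n}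
    (hν : conj f ν ≠ ⊤) :
    ∃ c : ℝ, conj f ν = c ∧ ∀ x, ((inner ℝ ν x - c : ℝ) : EReal) ≤ f x := by
  have hle : ∀ x, ((inner ℝ ν x : ℝ) : EReal) - f x ≤ conj f ν := fun x =>
    le_iSup (fun x : Vec n => ((inner ℝ ν x : ℝ) : EReal) - f x) x
  have hb : conj f ν ≠ ⊥ := by
    obtain ⟨x, hx⟩ := hf.proper
    obtain ⟨r, hr⟩ := hf.exists_coe hx
    have h := hle x
    rw [hr, ← EReal.coe_sub] at h
    exact ((EReal.bot_lt_coe _).trans_le h).ne'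
  refine ⟨(conj f ν).toReal, (EReal.coe_toReal hν hb).symm, fun x => ?_⟩
  rcases eq_or_ne (f x) ⊤ with hx | hx
  · simp [hx]
  obtain ⟨r, hr⟩ := hf.exists_coe hx.lt_top
  have h := hle x
  rw [hr, ← EReal.coe_toReal hν hb, ← EReal.coe_sub, EReal.coe_le_coe_iff] at h
  rw [hr, EReal.coe_le_coe_iff]
  linarith

/-- A dual point with objective value above `⊥` yields affine minorants of both functions, with
opposite slopes. -/
theorem exists_minorants_of_dual {f g : Vec n → EReal} (hf : IsCPC f) (hg : IsCPC g) {t : ℝ}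
    {ν : Vec n} (h : (t : EReal) < -conj f ν - conj g (-ν)) :
    ∃ c c' : ℝ, t < -c - c' ∧ (∀ x, ((inner ℝ ν x - c : ℝ) : EReal) ≤ f x) ∧
      ∀ x, ((inner ℝ (-ν) x - c' : ℝ) : EReal) ≤ g x := by
  have h1 : conj f ν ≠ ⊤ := by
    intro h1
    simp [h1] at h
  have h2 : conj g (-ν) ≠ ⊤ := by
    intro h2
    simp [h2] at h
  obtain ⟨c, hc, hc'⟩ := hf.exists_conj_eq h1
  obtain ⟨e, he, he'⟩ := hg.exists_conj_eq h2
  refine ⟨c, e, ?_, hc', he'⟩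
  rw [hc, he] at h
  exact_mod_cast h

theorem sum_coe_ereal {ι : Type*} (s : Finset ι) (φ : ι → ℝ) :
    ∑ i ∈ s, (φ i : EReal) = ((∑ i ∈ s, φ i : ℝ) : EReal) :=
  (map_sum (⟨⟨Real.toEReal, EReal.coe_zero⟩, EReal.coe_add⟩ : ℝ →+ EReal) φ s).symm

/-! ### Proximal points -/

/-- The objective `γ t + ½‖x - z‖²` is coercive on the epigraph of a function with an affine
minorant, so it attains its minimum there. -/
theorem exists_proxObjective_min {f : Vec n → EReal} (hf : IsCPC f) {ν : Vec n} {c : ℝ}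
    (hmin : ∀ x, ((inner ℝ ν x - c : ℝ) : EReal) ≤ f x) {γ : ℝ} (hγ : 0 < γ) (z : Vec n) :
    ∃ a, ∀ y, proxObjective (scale γ f) z a ≤ proxObjective (scale γ f) z y := by
  set S : Set (Vec n × ℝ) := {q | f q.1 ≤ (q.2 : EReal)} with hS
  set h : Vec n × ℝ → ℝ := fun q => γ * q.2 + (1 / 2) * ‖q.1 - z‖ ^ 2 with hh
  have hcont : Continuous h := by fun_prop
  obtain ⟨x₀, hx₀⟩ := hf.proper
  obtain ⟨r₀, hr₀⟩ := hf.exists_coe hx₀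
  set M := h (x₀, r₀) with hM
  set M' := |M + γ * c - γ * inner ℝ ν z| with hM'
  set ρ := 2 * (γ * ‖ν‖ + 1 + M') with hρ
  have hcl : IsClosed (S ∩ {q | h q ≤ M}) :=
    hf.closed.inter (isClosed_le hcont continuous_const)
  have hcomp : IsCompact (S ∩ {q | h q ≤ M}) := by
    refine ((isCompact_closedBall z ρ).prod
      (isCompact_Icc (a := inner ℝ ν z - ‖ν‖ * ρ - c) (b := M / γ))).of_isClosed_subset hcl ?_
    rintro ⟨y, t⟩ ⟨hy, hyM⟩
    have hy1 : inner ℝ ν y - c ≤ t := EReal.coe_le_coe_iff.1 ((hmin y).trans hy)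
    have hyM : γ * t + (1 / 2) * ‖y - z‖ ^ 2 ≤ M := hyM
    have hin : inner ℝ ν y = inner ℝ ν z + inner ℝ ν (y - z) := by
      rw [inner_sub_right]; ring
    have hcs : -(‖ν‖ * ‖y - z‖) ≤ inner ℝ ν (y - z) :=
      (abs_le.1 (abs_real_inner_le_norm ν (y - z))).1
    have h0 := norm_nonneg (y - z)
    have hM0 : 0 ≤ M' := abs_nonneg _
    have hMle : M + γ * c - γ * inner ℝ ν z ≤ M' := le_abs_self _
    have hγt := mul_le_mul_of_nonneg_left hy1 hγ.le
    have hγc := mul_le_mul_of_nonneg_left hcs hγ.le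
    have hR : ‖y - z‖ ≤ ρ := by
      by_contra! hlt
      have hν := mul_nonneg hγ.le (norm_nonneg ν)
      have h1 : 1 < ‖y - z‖ := by linarith
      have h2 : ‖y - z‖ * (1 + M') ≤ ‖y - z‖ * (‖y - z‖ / 2 - γ * ‖ν‖) :=
        mul_le_mul_of_nonneg_left (by linarith) h0
      have h3 : 1 * (1 + M') ≤ ‖y - z‖ * (1 + M') :=
        mul_le_mul_of_nonneg_right h1.le (by linarith)
      rw [hin] at hγt
      linarith
    refine ⟨by simpa [dist_eq_norm] using hR, ?_, ?_⟩
    · have := mul_le_mul_of_nonneg_left hR (norm_nonneg ν)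
      change _ ≤ t
      linarith
    · change t ≤ _
      rw [le_div_iff₀ hγ]
      linarith [sq_nonneg ‖y - z‖]
  obtain ⟨⟨a, t⟩, ⟨haS, haM⟩, hmin'⟩ := hcomp.exists_isMinOn
    ⟨(x₀, r₀), show f x₀ ≤ (r₀ : EReal) from hr₀.le, show h (x₀, r₀) ≤ M from le_rfl⟩
    hcont.continuousOn
  have haS : f a ≤ (t : EReal) := haS
  refine ⟨a, fun y => ?_⟩
  rcases eq_or_ne (f y) ⊤ with hy | hy
  · have hy' : proxObjective (scale γ f) z y = ⊤ := by
      simp only [proxObjective, scale, hy, EReal.coe_mul_top_of_pos hγ, EReal.top_add_coe]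
    exact hy' ▸ le_top
  obtain ⟨s, hs⟩ := hf.exists_coe hy.lt_top
  obtain ⟨r, hr⟩ := hf.exists_coe (haS.trans_lt (EReal.coe_lt_top t))
  have hrt : r ≤ t := by
    rw [hr] at haS
    exact_mod_cast haS
  have hle : h (a, t) ≤ h (y, s) := by
    rcases le_total (h (y, s)) M with hyM | hyM
    · exact hmin' ⟨show f y ≤ (s : EReal) from hs.le, hyM⟩
    · exact le_trans haM hyM
  have hle' : γ * r + (1 / 2) * ‖a - z‖ ^ 2 ≤ γ * s + (1 / 2) * ‖y - z‖ ^ 2 :=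
    (add_le_add_left (mul_le_mul_of_nonneg_left hrt hγ.le) _).trans hle
  simp only [proxObjective, scale, hr, hs]
  exact_mod_cast hle'

/-- The value at a proximal point is real, and `γ⁻¹(z - prox z)` is a subgradient there. -/
theorem exists_prox_subgradient {f : Vec n → EReal} (hf : IsCPC f) {ν : Vec n} {c : ℝ}
    (hmin : ∀ x, ((inner ℝ ν x - c : ℝ) : EReal) ≤ f x) {γ : ℝ} (hγ : 0 < γ) (z : Vec n) :
    ∃ r : ℝ, f (prox (scale γ f) z) = r ∧ ∀ (y : Vec n) (s : ℝ), f y = s →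
      γ * r + inner ℝ (z - prox (scale γ f) z) (y - prox (scale γ f) z) ≤ γ * s := by
  have hspec : ∀ y, proxObjective (scale γ f) z (prox (scale γ f) z) ≤
      proxObjective (scale γ f) z y :=
    Classical.epsilon_spec (exists_proxObjective_min hf hmin hγ z)
  set a := prox (scale γ f) z
  have hfin : f a < ⊤ := by
    obtain ⟨x₀, hx₀⟩ := hf.proper
    obtain ⟨r₀, hr₀⟩ := hf.exists_coe hx₀
    refine lt_top_iff_ne_top.2 fun ha => ?_
    have h := hspec x₀
    simp only [proxObjective, scale, ha, hr₀, EReal.coe_mul_top_of_pos hγ] at h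
    rw [EReal.top_add_coe, top_le_iff] at h
    exact absurd h (by exact_mod_cast EReal.coe_ne_top _)
  obtain ⟨r, hr⟩ := hf.exists_coe hfin
  refine ⟨r, hr, fun y s hs => ?_⟩
  -- Compare `a` with `θ y + (1 - θ) a` and divide by `θ`; the quadratic remainder is `O(θ)`.
  have key : ∀ θ : ℝ, 0 < θ → θ ≤ 1 →
      γ * r + inner ℝ (z - a) (y - a) ≤ γ * s + θ * ((1 / 2) * ‖y - a‖ ^ 2) := by
    intro θ h0 h1
    have hc := hf.convex y a θ h0.le h1
    rw [hr, hs] at hc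
    have hc' : f (θ • y + (1 - θ) • a) ≤ ((θ * s + (1 - θ) * r : ℝ) : EReal) := by
      exact_mod_cast hc
    obtain ⟨t, ht⟩ := hf.exists_coe (hc'.trans_lt (EReal.coe_lt_top _))
    rw [ht, EReal.coe_le_coe_iff] at hc'
    have h := hspec (θ • y + (1 - θ) • a)
    simp only [proxObjective, scale, hr, ht] at h
    have h : γ * r + (1 / 2) * ‖a - z‖ ^ 2 ≤
        γ * t + (1 / 2) * ‖θ • y + (1 - θ) • a - z‖ ^ 2 := by exact_mod_cast h
    have hv : θ • y + (1 - θ) • a - z = (a - z) + θ • (y - a) := by module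
    rw [hv, norm_add_sq_real, inner_smul_right, norm_smul, mul_pow, Real.norm_eq_abs, sq_abs] at h
    have hneg : inner ℝ (z - a) (y - a) = -inner ℝ (a - z) (y - a) := by
      rw [← inner_neg_left, neg_sub]
    rw [hneg]
    have hγc := mul_le_mul_of_nonneg_left hc' hγ.le
    have : θ * (γ * r - inner ℝ (a - z) (y - a)) ≤
        θ * (γ * s + θ * ((1 / 2) * ‖y - a‖ ^ 2)) := by
      linarith
    have := le_of_mul_le_mul_left this h0
    linarith
  have hlim : Tendsto (fun θ : ℝ => γ * s + θ * ((1 / 2) * ‖y - a‖ ^ 2)) (𝓝[>] 0)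
      (𝓝 (γ * s)) := by
    have : Tendsto (fun θ : ℝ => γ * s + θ * ((1 / 2) * ‖y - a‖ ^ 2)) (𝓝 0)
        (𝓝 (γ * s + 0 * ((1 / 2) * ‖y - a‖ ^ 2))) := Continuous.tendsto (by fun_prop) 0
    rw [zero_mul, add_zero] at this
    exact this.mono_left nhdsWithin_le_nhds
  refine ge_of_tendsto hlim ?_
  filter_upwards [Ioc_mem_nhdsGT (zero_lt_one' ℝ)] with θ hθ
  exact key θ hθ.1 hθ.2

/-! ### The Douglas-Rachford step in an inner product space -/

section Step

variable {E : Type*} [NormedAddCommGroup E] [InnerProductSpace ℝ E]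

/-- The identity behind both the descent estimate and nonexpansiveness: `z - a` and
`(2a - z) - b` are the (scaled) subgradients at `a` and `b`, and `z + b - a` is the next point. -/
theorem inner_subgradients_eq (z a b : E) :
    inner ℝ (z - a) a + inner ℝ ((2 : ℝ) • a - z - b) b =
      inner ℝ (z - (z + b - a)) (z + b - a) := by
  simp only [inner_sub_left, inner_sub_right, inner_add_left, inner_add_right, inner_smul_left,
    real_inner_comm a b, real_inner_comm a z, real_inner_comm b z]
  simp
  ring

theorem two_mul_gap_le {γ φ s : ℝ} {z a b x : E}
    (h : γ * φ + (inner ℝ (z - a) (x - a) + inner ℝ ((2 : ℝ) • a - z - b) (x - b)) ≤ γ * s) :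
    2 * γ * (φ - s) ≤ ‖z - x‖ ^ 2 - ‖z + b - a - x‖ ^ 2 - ‖b - a‖ ^ 2 := by
  have h1 := inner_subgradients_eq (z - x) (a - x) (b - x)
  have e1 : z - x - (a - x) = z - a := by abel
  have e2 : (2 : ℝ) • (a - x) - (z - x) - (b - x) = (2 : ℝ) • a - z - b := by module
  have e3 : z - x + (b - x) - (a - x) = z + b - a - x := by abel
  have e4 : inner ℝ (z - a) (x - a) = -inner ℝ (z - a) (a - x) := by
    rw [← inner_neg_right, neg_sub]
  have e5 : inner ℝ ((2 : ℝ) • a - z - b) (x - b) = -inner ℝ ((2 : ℝ) • a - z - b) (b - x) := by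
    rw [← inner_neg_right, neg_sub]
  rw [e1, e2, e3] at h1
  have h2 := norm_add_sq_real (z - x - (z + b - a - x)) (z + b - a - x)
  have e6 : z - x - (z + b - a - x) = -(b - a) := by abel
  rw [sub_add_cancel, e6, norm_neg] at h2
  rw [e6] at h1
  linarith

/-- Monotonicity of both subdifferentials makes the step nonexpansive. -/
theorem norm_step_sub_le {z a b z' a' b' : E}
    (h₁ : 0 ≤ inner ℝ ((z - a) - (z' - a')) (a - a'))
    (h₂ : 0 ≤ inner ℝ (((2 : ℝ) • a - z - b) - ((2 : ℝ) • a' - z' - b')) (b - b')) :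
    ‖(z + b - a) - (z' + b' - a')‖ ≤ ‖z - z'‖ := by
  have h := inner_subgradients_eq (z - z') (a - a') (b - b')
  have e1 : z - z' - (a - a') = (z - a) - (z' - a') := by abel
  have e2 : (2 : ℝ) • (a - a') - (z - z') - (b - b') =
    ((2 : ℝ) • a - z - b) - ((2 : ℝ) • a' - z' - b') := by module
  have e3 : z - z' + (b - b') - (a - a') = (z + b - a) - (z' + b' - a') := by abel
  rw [e1, e2, e3] at h
  set w := (z + b - a) - (z' + b' - a')
  have h3 := norm_add_sq_real (z - z' - w) w
  rw [sub_add_cancel] at h3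
  refine (sq_le_sq₀ (norm_nonneg _) (norm_nonneg _)).1 ?_
  nlinarith [sq_nonneg ‖z - z' - w‖]

/-! ### Asymptotics of sequences satisfying the primal and dual estimates -/

variable {γ p : ℝ} {z : ℕ → E} {φ : ℕ → ℝ}

theorem sum_gap_le {V : Type*} [NormedAddCommGroup V] {z : ℕ → V} {x : V} {s : ℝ}
    (hx : ∀ k, 2 * γ * (φ k - s) ≤ ‖z k - x‖ ^ 2 - ‖z (k + 1) - x‖ ^ 2 - ‖z (k + 1) - z k‖ ^ 2)
    (N : ℕ) :
    2 * γ * (∑ i ∈ Finset.range N, φ i - N * s) ≤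
      ‖z 0 - x‖ ^ 2 - ‖z N - x‖ ^ 2 - ∑ i ∈ Finset.range N, ‖z (i + 1) - z i‖ ^ 2 := by
  induction N with
  | zero => simp
  | succ N ih =>
    rw [Finset.sum_range_succ, Finset.sum_range_succ]
    push_cast
    linarith [hx N]

theorem le_sum_value {ν : E} {d : ℝ} (hν : ∀ k, d - inner ℝ ν (z (k + 1) - z k) ≤ φ k) (N : ℕ) :
    N * d - inner ℝ ν (z N - z 0) ≤ ∑ i ∈ Finset.range N, φ i := by
  induction N with
  | zero => simp
  | succ N ih =>
    have := hν N
    rw [inner_sub_right] at this ih ⊢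
    rw [Finset.sum_range_succ]
    push_cast
    linarith

theorem tendsto_step_zero (hγ : 0 < γ) (hanti : Antitone fun k => ‖z (k + 1) - z k‖)
    (hprim : ∀ ε > 0, ∃ (x : E) (s : ℝ), s < p + ε ∧ ∀ k, 2 * γ * (φ k - s) ≤
      ‖z k - x‖ ^ 2 - ‖z (k + 1) - x‖ ^ 2 - ‖z (k + 1) - z k‖ ^ 2)
    (hdual : ∀ ε > 0, ∃ (ν : E) (d : ℝ), p - ε < d ∧
      ∀ k, d - inner ℝ ν (z (k + 1) - z k) ≤ φ k) :
    Tendsto (fun k => z (k + 1) - z k) atTop (𝓝 0) := by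
  rw [tendsto_zero_iff_norm_tendsto_zero, Metric.tendsto_atTop]
  intro η hη
  have hε : 0 < η ^ 2 / (8 * γ) := by positivity
  obtain ⟨x, s, hs, hx⟩ := hprim _ hε
  obtain ⟨ν, d, hd, hν⟩ := hdual _ hε
  set C := ‖z 0 - x‖ ^ 2 + ‖γ • ν‖ ^ 2 + 2 * inner ℝ (γ • ν) (x - z 0) with hC
  have hbound : ∀ N : ℕ, N * ‖z (N + 1) - z N‖ ^ 2 ≤ C + N * (2 * γ * (s - d)) := by
    intro N
    have h1 := sum_gap_le hx N
    have h2 := mul_le_mul_of_nonneg_left (le_sum_value hν N) (by positivity : 0 ≤ 2 * γ)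
    have h3 : N * ‖z (N + 1) - z N‖ ^ 2 ≤ ∑ i ∈ Finset.range N, ‖z (i + 1) - z i‖ ^ 2 := by
      have := Finset.card_nsmul_le_sum (Finset.range N) (fun i => ‖z (i + 1) - z i‖ ^ 2)
        (‖z (N + 1) - z N‖ ^ 2) fun i hi =>
          pow_le_pow_left₀ (norm_nonneg _) (hanti (Finset.mem_range.1 hi).le) 2
      simpa using this
    -- The linear term of the dual estimate is absorbed by `‖z N - x‖ ^ 2`.
    have h4 : 2 * inner ℝ (γ • ν) (z N - x) ≤ ‖z N - x‖ ^ 2 + ‖γ • ν‖ ^ 2 := by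
      have := norm_sub_sq_real (γ • ν) (z N - x)
      linarith [sq_nonneg ‖γ • ν - (z N - x)‖]
    have h5 : inner ℝ (γ • ν) (z N - x) + inner ℝ (γ • ν) (x - z 0) =
        γ * inner ℝ ν (z N - z 0) := by
      rw [← inner_add_right, sub_add_sub_cancel, real_inner_smul_left]
    linarith
  have hgap : 2 * γ * (s - d) < η ^ 2 / 2 := by
    have : s - d < 2 * (η ^ 2 / (8 * γ)) := by linarith
    calc 2 * γ * (s - d) < 2 * γ * (2 * (η ^ 2 / (8 * γ))) := by gcongr
      _ = η ^ 2 / 2 := by field_simp; norm_num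
  obtain ⟨N, hN⟩ := exists_nat_gt (|C| / (η ^ 2 / 2))
  refine ⟨N, fun k hk => ?_⟩
  rw [dist_zero_right, norm_norm]
  refine lt_of_pow_lt_pow_left₀ 2 hη.le ?_
  have hkC : |C| < k * (η ^ 2 / 2) :=
    (div_lt_iff₀ (by positivity)).1 (hN.trans_le (by exact_mod_cast hk))
  have hk0 : (0 : ℝ) < k := by
    have : (0 : ℝ) ≤ |C| / (η ^ 2 / 2) := by positivity
    exact this.trans_lt (hN.trans_le (by exact_mod_cast hk))
  have h1 := hbound k
  have h2 := mul_lt_mul_of_pos_left hgap hk0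
  have h3 := le_abs_self C
  refine lt_of_mul_lt_mul_left (a := (k : ℝ)) ?_ hk0.le
  linarith

theorem eventually_lt_value (hΔ : Tendsto (fun k => z (k + 1) - z k) atTop (𝓝 0))
    (hdual : ∀ ε > 0, ∃ (ν : E) (d : ℝ), p - ε < d ∧
      ∀ k, d - inner ℝ ν (z (k + 1) - z k) ≤ φ k) {ε : ℝ} (hε : 0 < ε) :
    ∀ᶠ k in atTop, p - ε < φ k := by
  obtain ⟨ν, d, hd, hν⟩ := hdual ε hε
  have h : Tendsto (fun k => d - inner ℝ ν (z (k + 1) - z k)) atTop (𝓝 (d - inner ℝ ν (0 : E))) :=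
    tendsto_const_nhds.sub (tendsto_const_nhds.inner hΔ)
  rw [inner_zero_right, sub_zero] at h
  filter_upwards [h.eventually (lt_mem_nhds hd)] with k hk
  exact hk.trans_le (hν k)

theorem tendsto_average (hγ : 0 < γ) (hΔ : Tendsto (fun k => z (k + 1) - z k) atTop (𝓝 0))
    (hprim : ∀ ε > 0, ∃ (x : E) (s : ℝ), s < p + ε ∧ ∀ k, 2 * γ * (φ k - s) ≤
      ‖z k - x‖ ^ 2 - ‖z (k + 1) - x‖ ^ 2 - ‖z (k + 1) - z k‖ ^ 2)
    (hdual : ∀ ε > 0, ∃ (ν : E) (d : ℝ), p - ε < d ∧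
      ∀ k, d - inner ℝ ν (z (k + 1) - z k) ≤ φ k) :
    Tendsto (fun N : ℕ => (N : ℝ)⁻¹ * ∑ i ∈ Finset.range N, φ i) atTop (𝓝 p) := by
  refine tendsto_order.2 ⟨fun l hl => ?_, fun u hu => ?_⟩
  · obtain ⟨ν, d, hd, hν⟩ := hdual (p - l) (by linarith)
    have h : Tendsto (fun k => d - inner ℝ ν (z (k + 1) - z k)) atTop
        (𝓝 (d - inner ℝ ν (0 : E))) :=
      tendsto_const_nhds.sub (tendsto_const_nhds.inner hΔ)
    rw [inner_zero_right, sub_zero] at h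
    filter_upwards [h.cesaro.eventually (lt_mem_nhds (by linarith : l < d))] with N hN
    refine hN.trans_le ?_
    gcongr with i
    exact hν i
  · obtain ⟨x, s, hs, hx⟩ := hprim (u - p) (by linarith)
    have h : Tendsto (fun N : ℕ => s + ‖z 0 - x‖ ^ 2 / (2 * γ) / (N : ℝ)) atTop (𝓝 (s + 0)) :=
      tendsto_const_nhds.add (tendsto_const_div_atTop_nhds_zero_nat _)
    rw [add_zero] at h
    filter_upwards [h.eventually (gt_mem_nhds (by linarith : s < u)), eventually_gt_atTop 0]
      with N hN hN0
    refine lt_of_le_of_lt ?_ hN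
    have hN0 : (0 : ℝ) < N := by exact_mod_cast hN0
    have h1 := sum_gap_le hx N
    have h2 : 0 ≤ ∑ i ∈ Finset.range N, ‖z (i + 1) - z i‖ ^ 2 :=
      Finset.sum_nonneg fun i _ => sq_nonneg _
    have h3 : ∑ i ∈ Finset.range N, φ i - N * s ≤ ‖z 0 - x‖ ^ 2 / (2 * γ) := by
      rw [le_div_iff₀ (by positivity)]
      linarith [sq_nonneg ‖z N - x‖]
    rw [inv_mul_le_iff₀ hN0, mul_add, mul_div_cancel₀ _ hN0.ne']
    linarith

end Step

theorem frequently_lt_of_tendsto_average {φ : ℕ → ℝ} {p u : ℝ}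
    (h : Tendsto (fun N : ℕ => (N : ℝ)⁻¹ * ∑ i ∈ Finset.range N, φ i) atTop (𝓝 p))
    (hu : p < u) : ∃ᶠ k in atTop, φ k < u := by
  intro hev
  have hev : ∀ᶠ k in atTop, u ≤ φ k := by simpa using hev
  -- Truncating `φ` from above at `u` gives a sequence that is eventually `u`.
  have hm : Tendsto (fun k => min (φ k) u) atTop (𝓝 u) :=
    tendsto_const_nhds.congr' (hev.mono fun k hk => (min_eq_right hk).symm)
  refine hu.not_ge (le_of_tendsto_of_tendsto' hm.cesaro h fun N => ?_)
  gcongr with i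
  exact min_le_left _ _

/-! ### Primal solutions -/

/-- If `f` and `g` are evaluated along two sequences with a common limit, and the sums of the values
have the lower limit `primalValue f g < ⊤`, the common limit is a solution. -/
theorem isPrimalSolution_of_tendsto {f g : Vec n → EReal} (hf : IsCPC f) (hg : IsCPC g)
    (htop : primalValue f g ≠ ⊤) {a b : ℕ → Vec n} {x : Vec n}
    (ha : Tendsto a atTop (𝓝 x)) (hb : Tendsto b atTop (𝓝 x))
    (hlim : liminf (fun k => f (a k) + g (b k)) atTop = primalValue f g) :
    IsPrimalSolution f g x := by
  have hlsc : LowerSemicontinuous fun q : Vec n × Vec n => f q.1 + g q.2 :=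
    (hf.lowerSemicontinuous.comp continuous_fst).add'
      (hg.lowerSemicontinuous.comp continuous_snd) fun q =>
        EReal.continuousAt_add (Or.inr (hg.ne_bot _)) (Or.inl (hf.ne_bot _))
  have hle : f x + g x ≤ primalValue f g :=
    (hlsc.le_liminf (x, x)).trans ((ha.prodMk_nhds hb).liminf_le_liminf_comp.trans_eq hlim)
  have hlt : f x + g x < ⊤ := hle.trans_lt htop.lt_top
  refine ⟨show f x < ⊤ from lt_top_iff_ne_top.2 fun h => ?_,
    show g x < ⊤ from lt_top_iff_ne_top.2 fun h => ?_,
    le_antisymm hle (iInf_le (fun y => f y + g y) x)⟩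
  · simp [h, EReal.top_add_of_ne_bot (hg.ne_bot x)] at hlt
  · simp [h, EReal.add_top_of_ne_bot (hf.ne_bot x)] at hlt

end DRS

theorem theorem4p3 {n : ℕ} (f g : DRS.Vec n → EReal)
    (hf : DRS.IsCPC f) (hg : DRS.IsCPC g)
    (hstrong : DRS.dualValue f g = DRS.primalValue f g)
    (hbot : DRS.primalValue f g ≠ ⊥) (htop : DRS.primalValue f g ≠ ⊤)
    (hfeas : DRS.PrimalFeasible f g)
    (hnosol : ¬ ∃ x, DRS.IsPrimalSolution f g x)
    (γ : ℝ) (hγ : 0 < γ)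
    (z xh x : ℕ → DRS.Vec n) (hdrs : DRS.IsDRS γ f g z xh x) :
    Filter.Tendsto (fun k : ℕ => x (k + 1) - xh k) Filter.atTop (𝓝 0) ∧
    Filter.Tendsto
      (fun k : ℕ => ((1 / ((k : ℝ) + 1) : ℝ) : EReal) *
        ∑ i ∈ Finset.range (k + 1), (f (xh i) + g (x (i + 1))))
      Filter.atTop (𝓝 (DRS.primalValue f g)) ∧
    Filter.liminf (fun k : ℕ => f (xh k) + g (x (k + 1))) Filter.atTop
      = DRS.primalValue f g ∧
    (¬ ∃ a : DRS.Vec n, Filter.Tendsto xh Filter.atTop (𝓝 a)) ∧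
    (¬ ∃ a : DRS.Vec n, Filter.Tendsto (fun k : ℕ => x (k + 1)) Filter.atTop (𝓝 a)) := by
  obtain ⟨p, hp⟩ : ∃ p : ℝ, DRS.primalValue f g = p :=
    ⟨_, (EReal.coe_toReal htop hbot).symm⟩
  have hdual : ∀ ε > 0, ∃ (ν : DRS.Vec n) (c c' : ℝ), p - ε < -c - c' ∧
      (∀ y, ((inner ℝ ν y - c : ℝ) : EReal) ≤ f y) ∧
      ∀ y, ((inner ℝ (-ν) y - c' : ℝ) : EReal) ≤ g y := by
    intro ε hε
    have h : ((p - ε : ℝ) : EReal) < DRS.dualValue f g := by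
      rw [hstrong, hp, EReal.coe_lt_coe_iff]
      linarith
    obtain ⟨ν, hν⟩ := lt_iSup_iff.1 h
    exact ⟨ν, DRS.exists_minorants_of_dual hf hg hν⟩
  have hprim : ∀ ε > 0, ∃ (y : DRS.Vec n) (s t : ℝ), s + t < p + ε ∧ f y = s ∧ g y = t := by
    intro ε hε
    have h : DRS.primalValue f g < ((p + ε : ℝ) : EReal) := by
      rw [hp, EReal.coe_lt_coe_iff]
      linarith
    obtain ⟨y, hy⟩ := iInf_lt_iff.1 h
    have hfy : f y < ⊤ := by
      refine lt_top_iff_ne_top.2 fun h => ?_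
      simp [h, EReal.top_add_of_ne_bot (hg.ne_bot y)] at hy
    have hgy : g y < ⊤ := by
      refine lt_top_iff_ne_top.2 fun h => ?_
      simp [h, EReal.add_top_of_ne_bot (hf.ne_bot y)] at hy
    obtain ⟨s, hs⟩ := hf.exists_coe hfy
    obtain ⟨t, ht⟩ := hg.exists_coe hgy
    rw [hs, ht] at hy
    exact ⟨y, s, t, by exact_mod_cast hy, hs, ht⟩
  obtain ⟨ν₀, c₀, c₀', -, hc₀, hc₀'⟩ := hdual 1 one_pos
  have hF : ∀ k, ∃ r : ℝ, f (xh k) = r ∧ ∀ (y : DRS.Vec n) (s : ℝ), f y = s →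
      γ * r + inner ℝ (z k - xh k) (y - xh k) ≤ γ * s := by
    intro k
    rw [hdrs.half k]
    exact DRS.exists_prox_subgradient hf hc₀ hγ (z k)
  have hG : ∀ k, ∃ r : ℝ, g (x (k + 1)) = r ∧ ∀ (y : DRS.Vec n) (s : ℝ), g y = s →
      γ * r + inner ℝ ((2 : ℝ) • xh k - z k - x (k + 1)) (y - x (k + 1)) ≤ γ * s := by
    intro k
    rw [hdrs.full k]
    exact DRS.exists_prox_subgradient hg hc₀' hγ _
  choose F hF hFs using hF
  choose G hG hGs using hG
  have hstep : ∀ k, z (k + 1) - z k = x (k + 1) - xh k := fun k => by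
    rw [hdrs.next k]
    abel
  have hprim' : ∀ ε > 0, ∃ (y : DRS.Vec n) (s : ℝ), s < p + ε ∧ ∀ k,
      2 * γ * (F k + G k - s) ≤
        ‖z k - y‖ ^ 2 - ‖z (k + 1) - y‖ ^ 2 - ‖z (k + 1) - z k‖ ^ 2 := by
    intro ε hε
    obtain ⟨y, s, t, hst, hs, ht⟩ := hprim ε hε
    refine ⟨y, s + t, hst, fun k => ?_⟩
    rw [hstep k, hdrs.next k]
    exact DRS.two_mul_gap_le (by linarith [hFs k y s hs, hGs k y t ht])
  have hdual' : ∀ ε > 0, ∃ (ν : DRS.Vec n) (d : ℝ), p - ε < d ∧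
      ∀ k, d - inner ℝ ν (z (k + 1) - z k) ≤ F k + G k := by
    intro ε hε
    obtain ⟨ν, c, c', hd, hc, hc'⟩ := hdual ε hε
    refine ⟨ν, -c - c', hd, fun k => ?_⟩
    have h1 := hc (xh k)
    have h2 := hc' (x (k + 1))
    rw [hF, EReal.coe_le_coe_iff] at h1
    rw [hG, EReal.coe_le_coe_iff, inner_neg_left] at h2
    rw [hstep k, inner_sub_right]
    linarith
  have hanti : Antitone fun k => ‖z (k + 1) - z k‖ := by
    refine antitone_nat_of_succ_le fun k => ?_
    have h := DRS.norm_step_sub_le (z := z (k + 1)) (a := xh (k + 1)) (b := x (k + 1 + 1))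
      (z' := z k) (a' := xh k) (b' := x (k + 1)) ?_ ?_
    · rwa [← hdrs.next k, ← hdrs.next (k + 1)] at h
    · have h1 := hFs k _ _ (hF (k + 1))
      have h2 := hFs (k + 1) _ _ (hF k)
      rw [← neg_sub (xh (k + 1)) (xh k), inner_neg_right] at h2
      rw [inner_sub_left]
      linarith
    · have h1 := hGs k _ _ (hG (k + 1))
      have h2 := hGs (k + 1) _ _ (hG k)
      rw [← neg_sub (x (k + 1 + 1)) (x (k + 1)), inner_neg_right] at h2
      rw [inner_sub_left]
      linarith
  have hΔ := DRS.tendsto_step_zero hγ hanti hprim' hdual'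
  have havg := DRS.tendsto_average hγ hΔ hprim' hdual'
  have hval : ∀ k, f (xh k) + g (x (k + 1)) = ((F k + G k : ℝ) : EReal) := fun k => by
    rw [hF, hG, EReal.coe_add]
  have hliminf : Filter.liminf (fun k : ℕ => f (xh k) + g (x (k + 1))) Filter.atTop
      = DRS.primalValue f g := by
    simp only [hval, hp]
    refine le_antisymm (EReal.le_of_forall_lt_iff_le.1 fun u hu => ?_)
      (EReal.ge_of_forall_gt_iff_ge.1 fun l hl => ?_)
    · refine Filter.liminf_le_of_frequently_le' ?_
      refine (DRS.frequently_lt_of_tendsto_average havg (EReal.coe_lt_coe_iff.1 hu)).mono ?_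
      exact fun k hk => EReal.coe_le_coe_iff.2 hk.le
    · have hl := EReal.coe_lt_coe_iff.1 hl
      refine Filter.le_liminf_of_le (h := ?_)
      filter_upwards [DRS.eventually_lt_value hΔ hdual' (sub_pos.2 hl)] with k hk
      exact EReal.coe_le_coe_iff.2 (by linarith)
  have hΔ' : Filter.Tendsto (fun k : ℕ => x (k + 1) - xh k) Filter.atTop (𝓝 0) :=
    hΔ.congr hstep
  refine ⟨hΔ', ?_, hliminf, ?_, ?_⟩
  · have h := (continuous_coe_real_ereal.tendsto p).comp
      (havg.comp (Filter.tendsto_add_atTop_nat 1))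
    rw [hp]
    refine h.congr fun k => ?_
    simp only [hval, Function.comp_apply, one_div, DRS.sum_coe_ereal, ← EReal.coe_mul]
    push_cast
    rfl
  · rintro ⟨a, ha⟩
    have hb : Filter.Tendsto (fun k => x (k + 1)) Filter.atTop (𝓝 a) := by
      simpa using hΔ'.add ha
    exact hnosol ⟨a, DRS.isPrimalSolution_of_tendsto hf hg htop ha hb hliminf⟩
  · rintro ⟨a, hb⟩
    have ha : Filter.Tendsto xh Filter.atTop (𝓝 a) := by
      simpa using hb.sub hΔ'
    exact hnosol ⟨a, DRS.isPrimalSolution_of_tendsto hf hg htop ha hb hliminf⟩
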